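/- A signed graph $(G,\Sigma^-)$ is a finite simple graph $G$ together with a set $\Sigma^-\subseteq E(G)$ of negative edges; its adjacency matrix has entries $1$ (positive edge), $-1$ (negative edge) and $0$ (no edge). It is bipartite (regular) if $G$ is. For an eigenvalue $\mu$ of multiplicity $k$ of the adjacency matrix of a signed graph $\dot G$, a star set is a set $S$ of $k$ vertices such that $\mu$ is not an eigenvalue of the induced signed subgraph $\dot G-S$, and $\dot G-S$ is then called a star complement for $\mu$ in $\dot G$. Two signed graphs are switching isomorphic, written $\cong^s$, if their adjacency matrices are conjugate by a product of a permutation matrix and a diagonal matrix with diagonal entries $\pm1$. For vertices $u,v$ let $w_2(u,v)$ be the number of positive minus the number of negative walks of length $2$ from $u$ to $v$, the sign of a walk being the product of the signs of its edges. A signed graph of order $n$ is an $SRG^s(n,r,a,b,c)$ (signed strongly regular) if it is regular of degree $r$, is neither totally disconnected nor complete with all edges of the same sign, and $w_2(u,v)$ equals $a$, $b$, $c$ for all distinct $u,v$ that are joined by a positive edge, joined by a negative edge, and non-adjacent, respectively; $SRG^s(2s)$ means $SRG^s(2s,s,0,0,0)$. Let $\mathcal N(\mathcal H)$ be the set of natural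 numbers of at least one of the forms: (i) $2^p$ with $p\ge1$; (ii) $2^p(q^h+1)$ with $p\ge2$, $h\ge1$ and $q$ prime; (iii) $2^pq(q+1)$ with $p\ge2$ and $q\equiv3\pmod 4$ prime; (iv) $q+1$ with $q\equiv3\pmod 4$ a prime power; (v) $2(q+1)$ with $q\equiv1\pmod 4$ a prime power. **Theorem.** Let $\mu$ be a real number such that $s=\mu^2\ge2$ is an integer, and let $\dot H$ be a totally disconnected graph of order $s$. Then there is a signed bipartite graph of maximum order among all signed bipartite graphs that have $\dot H$ as a star complement for the eigenvalue $\mu$. Let $\dot{\mathscr B}_m$ be any such graph of maximum order. 1. If $s$ is odd, then $\dot{\mathscr B}_m\cong^s(K_{1,s},\emptyset)$. 2. If $s\equiv2\pmod4$, then $\dot{\mathscr B}_m\cong^s(K_{2,s},E(K_{1,s/2}))$, where the negative edges join one fixed vertex of the part of size $2$ to $s/2$ vertices of the other part. 3. If $s\in\mathcal N(\mathcal H)$, then $\dot{\mathscr B}_m$ is an $SRG^s(2s)$; in particular it is switching isomorphic to an $SRG^s(2s)$. -/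

import Mathlib

/-- A signed graph `(G, Σ⁻)`: a simple graph together with its set of negative edges. -/
structure SignedGraph (V : Type*) where
  /-- the underlying simple graph -/
  graph : SimpleGraph V
  /-- the set of negative edges; the other edges are positive -/
  neg : Set (Sym2 V)
  neg_subset : neg ⊆ graph.edgeSet

namespace SignedGraph

/-- `u` and `v` are joined by a positive edge. -/
def PosAdj {V : Type*} (G : SignedGraph V) (u v : V) : Prop :=
  G.graph.Adj u v ∧ s(u, v) ∉ G.neg

/-- `u` and `v` are joined by a negative edge. -/
def NegAdj {V : Type*} (G : SignedGraph V) (u v : V) : Prop :=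
  s(u, v) ∈ G.neg

open Classical in
/-- The adjacency matrix: `1` on positive edges, `-1` on negative edges, `0` elsewhere. -/
noncomputable def adjMatrix {V : Type*} (G : SignedGraph V) : Matrix V V ℝ :=
  Matrix.of fun u v => if G.PosAdj u v then 1 else if G.NegAdj u v then -1 else 0

/-- The signed subgraph induced by a set of vertices. -/
def induce {V : Type*} (G : SignedGraph V) (t : Set V) : SignedGraph t where
  graph := G.graph.induce t
  neg := {e | Sym2.map Subtype.val e ∈ G.neg}
  neg_subset := by
    intro e he
    induction e with
    | h u v =>
      have h := G.neg_subset he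
      simpa using h

/-- No edges at all. -/
def IsTotallyDisconnected {V : Type*} (G : SignedGraph V) : Prop :=
  G.graph = ⊥

/-- Complete, with all edges of the same sign. -/
def IsHomogeneousComplete {V : Type*} (G : SignedGraph V) : Prop :=
  G.graph = ⊤ ∧ (G.neg = ∅ ∨ G.neg = G.graph.edgeSet)

/-- A signed graph is bipartite when its underlying graph is. -/
def IsBipartite {V : Type*} (G : SignedGraph V) : Prop :=
  G.graph.IsBipartite

/-- `μ` is an eigenvalue of the adjacency matrix. -/
def IsEigenvalue {V : Type*} [Fintype V] (G : SignedGraph V) (μ : ℝ) : Prop :=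
  Module.End.HasEigenvalue G.adjMatrix.mulVecLin μ

/-- The multiplicity of `μ`: the dimension of its eigenspace (the adjacency matrix is real
symmetric, so that this is also the algebraic multiplicity). -/
noncomputable def multiplicity {V : Type*} [Fintype V] (G : SignedGraph V) (μ : ℝ) : ℕ :=
  Module.finrank ℝ (Module.End.eigenspace G.adjMatrix.mulVecLin μ)

open Classical in
/-- `S` is a star set for the eigenvalue `μ`: its size is the multiplicity of `μ`, and `μ` is not
an eigenvalue of `G - S`. -/
def IsStarSet {V : Type*} [Fintype V] (G : SignedGraph V) (μ : ℝ) (S : Set V) : Prop :=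
  G.IsEigenvalue μ ∧ S.ncard = G.multiplicity μ ∧ ¬ (G.induce Sᶜ).IsEigenvalue μ

/-- Isomorphism of signed graphs: the adjacency matrices agree after relabelling the vertices,
that is, up to conjugation by a permutation matrix. -/
def Isomorphic {V W : Type*} (G₁ : SignedGraph V) (G₂ : SignedGraph W) : Prop :=
  ∃ e : V ≃ W, G₂.adjMatrix.submatrix e e = G₁.adjMatrix

/-- Switching equivalence: the second adjacency matrix is `D⁻¹ * A₁ * D` for a diagonal matrix `D`
with diagonal entries `±1`. -/
def SwitchingEquivalent {V : Type*} (G₁ G₂ : SignedGraph V) : Prop :=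
  ∃ d : V → ℝ, (∀ v, d v = 1 ∨ d v = -1) ∧
    ∀ u v, G₂.adjMatrix u v = (d u)⁻¹ * G₁.adjMatrix u v * d v

/-- `G₁` is isomorphic to a signed graph that is switching equivalent to `G₂`. -/
def SwitchingIsomorphic {V W : Type*} (G₁ : SignedGraph V) (G₂ : SignedGraph W) : Prop :=
  ∃ K : SignedGraph W, G₁.Isomorphic K ∧ K.SwitchingEquivalent G₂

/-- `H` is (up to isomorphism) a star complement for `μ` in `G`. -/
def HasStarComplement {V U : Type*} [Fintype V] (G : SignedGraph V) (H : SignedGraph U)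
    (μ : ℝ) : Prop :=
  ∃ S : Set V, G.IsStarSet μ S ∧ (G.induce Sᶜ).Isomorphic H

/-- `B` is a maximal signed bipartite graph with `H` as a star complement for `μ`: it is a signed
bipartite graph with `H` as a star complement for `μ`, and no finite signed graph of this kind has
more vertices. -/
def IsMaximalBipartite {V U : Type*} [Fintype V] (B : SignedGraph V) (H : SignedGraph U)
    (μ : ℝ) : Prop :=
  B.IsBipartite ∧ B.HasStarComplement H μ ∧
    ∀ (n : ℕ) (B' : SignedGraph (Fin n)),
      B'.IsBipartite → B'.HasStarComplement H μ → n ≤ Fintype.card V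

/-- The number of positive walks minus the number of negative walks of length two from `u`
to `v`. -/
noncomputable def w₂ {V : Type*} (G : SignedGraph V) (u v : V) : ℤ :=
  ({x | (G.PosAdj u x ∧ G.PosAdj x v) ∨ (G.NegAdj u x ∧ G.NegAdj x v)}.ncard : ℤ) -
    ({x | (G.PosAdj u x ∧ G.NegAdj x v) ∨ (G.NegAdj u x ∧ G.PosAdj x v)}.ncard : ℤ)

/-- `G` is a signed strongly regular graph `SRGˢ(n, r, a, b, c)`. -/
structure IsSRG {V : Type*} [Fintype V] (G : SignedGraph V) (n r : ℕ) (a b c : ℤ) : Prop where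
  card_eq : Fintype.card V = n
  regular : ∀ v, (G.graph.neighborSet v).ncard = r
  not_homogeneousComplete : ¬ G.IsHomogeneousComplete
  not_totallyDisconnected : ¬ G.IsTotallyDisconnected
  w₂_of_pos : ∀ u v, G.PosAdj u v → G.w₂ u v = a
  w₂_of_neg : ∀ u v, G.NegAdj u v → G.w₂ u v = b
  w₂_of_not_adj : ∀ u v, u ≠ v → ¬ G.graph.Adj u v → G.w₂ u v = c

/-- `(K_{1,s}, ∅)`: the star with `s` leaves and all edges positive. -/
def positiveStar (s : ℕ) : SignedGraph (Fin 1 ⊕ Fin s) where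
  graph := completeBipartiteGraph (Fin 1) (Fin s)
  neg := ∅
  neg_subset := Set.empty_subset _

/-- `(K_{2,s}, E(K_{1,s/2}))`: the complete bipartite graph in which exactly the edges joining one
fixed vertex of the part of size `2` to the first `s / 2` vertices of the other part are
negative. -/
def halfNegativeK2 (s : ℕ) : SignedGraph (Fin 2 ⊕ Fin s) where
  graph := completeBipartiteGraph (Fin 2) (Fin s)
  neg := {e | ∃ j : Fin s, (j : ℕ) < s / 2 ∧ e = s(Sum.inl 0, Sum.inr j)}
  neg_subset := by
    rintro e ⟨j, -, rfl⟩
    simp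

end SignedGraph

/-- The set `𝒩(ℋ)` of natural numbers that have at least one of five decompositions known to give
orders of Hadamard matrices. -/
def hadamardOrders : Set ℕ :=
  {n | (∃ p : ℕ, 1 ≤ p ∧ n = 2 ^ p) ∨
    (∃ p h q : ℕ, 2 ≤ p ∧ 1 ≤ h ∧ q.Prime ∧ n = 2 ^ p * (q ^ h + 1)) ∨
    (∃ p q : ℕ, 2 ≤ p ∧ q % 4 = 3 ∧ q.Prime ∧ n = 2 ^ p * q * (q + 1)) ∨
    (∃ q : ℕ, q % 4 = 3 ∧ IsPrimePow q ∧ n = q + 1) ∨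
    (∃ q : ℕ, q % 4 = 1 ∧ IsPrimePow q ∧ n = 2 * (q + 1))}

/-! Order the vertices so that the star set `S` comes first. The star complement has no edges, so
the adjacency matrix has blocks `A_S`, `N`, `Nᵀ`, `0`, where `N` has `s` columns, and `S` is a star
set for `μ` exactly when `μ² I = μ A_S + N Nᵀ` (`isStarSet_iff`). On the diagonal, `s` entries from
`{0, 1, -1}` have squares with sum `s`, so none vanishes and each vertex of `S` is joined to the
whole complement. Bipartiteness then gives `A_S = 0`, and `N Nᵀ = s I`. The graphs in question are
therefore the matrices of pairwise orthogonal `±1` rows of length `s`, and maximum order means the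
largest number `k` of rows.

Rank gives `k ≤ s`, two orthogonal rows force `s` even, and three force `4 ∣ s`. This settles `k =
1` and `k = 2`, where switching columns yields the standard forms. The value `k = s` is attained
once a Hadamard matrix of order `s` exists; then `A² = s I`, which is the SRG condition. Such
matrices for `hadamardOrders` come from Kronecker products, Paley's constructions, and the
Goethals–Seidel array applied to Golay pairs. -/

namespace Matrix

/-! ### Hadamard matrices: criterion and Kronecker products. -/

open scoped Kronecker

/-- Integer Hadamard matrices of order `n` exist. -/
def HadamardExists (n : ℕ) : Prop := ∃ M : Matrix (Fin n) (Fin n) ℤ, M.IsHadamard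

theorem IsHadamard.of_entries {ι : Type*} [Fintype ι] [DecidableEq ι] {M : Matrix ι ι ℤ}
    (h : ∀ i j, M i j = 1 ∨ M i j = -1) (hM : M * Mᵀ = (Fintype.card ι : ℤ) • 1) :
    M.IsHadamard := by
  rcases isEmpty_or_nonempty ι with hι | hι
  · exact ⟨fun i => hι.elim i, Subsingleton.elim _ _, Subsingleton.elim _ _⟩
  · refine IsHadamard.of_mul_conjTranspose
      (fun i j => Unitary.mem_iff_eq_one_or_eq_neg_one.mpr (h i j)) ?_ ?_
    · rw [← hM]; congr 1
    · exact IsRegular.of_ne_zero (by simp)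

theorem IsHadamard.hadamardExists {ι : Type*} [Fintype ι] [DecidableEq ι] {M : Matrix ι ι ℤ}
    (hM : M.IsHadamard) {n : ℕ} (hn : Fintype.card ι = n) : HadamardExists n :=
  ⟨_, hM.reindex (Fintype.equivFinOfCardEq hn) (Fintype.equivFinOfCardEq hn)⟩

theorem HadamardExists.mul {m n : ℕ} (hm : HadamardExists m) (hn : HadamardExists n) :
    HadamardExists (m * n) := by
  obtain ⟨A, hA⟩ := hm
  obtain ⟨B, hB⟩ := hn
  exact (hA.kronecker hB).hadamardExists (by simp)

theorem hadamardExists_one : HadamardExists 1 :=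
  ⟨1, IsHadamard.of_entries (fun i j => Or.inl (by
    rw [Subsingleton.elim i j, one_apply_eq])) (by simp)⟩

theorem hadamardExists_two : HadamardExists 2 :=
  ⟨!![1, 1; 1, -1], IsHadamard.of_entries (by simp [Fin.forall_fin_two])
    (by ext i j; fin_cases i <;> fin_cases j <;> simp [mul_apply])⟩

theorem hadamardExists_two_pow (p : ℕ) : HadamardExists (2 ^ p) := by
  induction p with
  | zero => exact hadamardExists_one
  | succ p ih => exact ih.mul hadamardExists_two

/-! ### Hadamard matrices from the quadratic character of a finite field. -/

section Paley

variable {F : Type*} [Field F] [Fintype F] [DecidableEq F]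

/-- The substitution `x = (i - j) / (i - k)` turns the sum into `χ(-1)` times the Jacobi sum of `χ`
with itself, which is `-χ(-1)`. -/
theorem sum_quadraticChar_mul_quadraticChar (hF : ringChar F ≠ 2) {i k : F} (h : i ≠ k) :
    ∑ j, quadraticChar F (i - j) * quadraticChar F (k - j) = -1 := by
  have hJ := jacobiSum_nontrivial_inv (quadraticChar_ne_one hF)
  rw [(quadraticChar_isQuadratic F).inv, jacobiSum] at hJ
  have hd : i - k ≠ 0 := sub_ne_zero.mpr h
  have h1 : quadraticChar F (-1) * quadraticChar F (-1) = 1 := by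
    rw [← map_mul]; simp
  have e : ∑ j, quadraticChar F (i - j) * quadraticChar F (k - j) =
      quadraticChar F (-1) * ∑ x, quadraticChar F x * quadraticChar F (1 - x) := by
    rw [Finset.mul_sum]
    refine Fintype.sum_equiv ((Equiv.subLeft i).trans (Equiv.divRight₀ (i - k) hd)) _ _ ?_
    intro j
    simp only [Equiv.trans_apply, Equiv.subLeft_apply, Equiv.divRight₀_apply]
    have hs := quadraticChar_sq_one hd
    have e1 : quadraticChar F (i - j) =
        quadraticChar F ((i - j) / (i - k)) * quadraticChar F (i - k) := by
      rw [← map_mul, div_mul_cancel₀ _ hd]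
    have e2 : quadraticChar F (k - j) = quadraticChar F (-1) *
        (quadraticChar F (1 - (i - j) / (i - k)) * quadraticChar F (i - k)) := by
      rw [← map_mul, ← map_mul]
      congr 1
      field_simp
      ring
    rw [e1, e2]
    linear_combination quadraticChar F ((i - j) / (i - k)) * quadraticChar F (-1) *
        quadraticChar F (1 - (i - j) / (i - k)) * hs
  rw [e, hJ]
  linear_combination -h1

theorem sum_quadraticChar_sub (hF : ringChar F ≠ 2) (i : F) :
    ∑ j, quadraticChar F (i - j) = 0 := by
  rw [← quadraticChar_sum_zero hF]
  exact Fintype.sum_equiv (Equiv.subLeft i) _ _ fun _ => rfl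

theorem sum_quadraticChar_mul_self (i : F) :
    ∑ j, quadraticChar F (i - j) * quadraticChar F (i - j) = Fintype.card F - 1 := by
  have : ∀ j, quadraticChar F (i - j) * quadraticChar F (i - j) = 1 - if i = j then 1 else 0 := by
    intro j
    split_ifs with h
    · simp [h]
    · rw [← sq, quadraticChar_sq_one (sub_ne_zero.mpr h)]; simp
  simp [this, -quadraticChar_apply]

variable (F) in
/-- The conference matrix of Paley, bordering the matrix of the quadratic character. -/
def paleyConference : Matrix (Option F) (Option F) ℤ := of fun
  | none, none => 0
  | none, some _ => 1
  | some _, none => quadraticChar F (-1)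
  | some i, some j => quadraticChar F (i - j)

theorem quadraticChar_neg_one_mul_self : quadraticChar F (-1) * quadraticChar F (-1) = 1 := by
  rw [← map_mul]; simp

theorem paleyConference_mul_transpose (hF : ringChar F ≠ 2) :
    paleyConference F * (paleyConference F)ᵀ = (Fintype.card F : ℤ) • 1 := by
  ext i j
  rcases i with _ | i <;> rcases j with _ | j
  · simp [mul_apply, paleyConference]
  · simp [mul_apply, paleyConference, -quadraticChar_apply, sum_quadraticChar_sub hF]
  · simp [mul_apply, paleyConference, -quadraticChar_apply, sum_quadraticChar_sub hF]
  · rw [smul_apply]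
    rcases eq_or_ne i j with rfl | h
    · simp [mul_apply, paleyConference, -quadraticChar_apply, sum_quadraticChar_mul_self,
        quadraticChar_neg_one_mul_self]
    · simp [mul_apply, paleyConference, -quadraticChar_apply, sum_quadraticChar_mul_quadraticChar hF h,
        quadraticChar_neg_one_mul_self, h]

/-- The border column `χ(-1)` makes the whole matrix skew for `q ≡ 3` and symmetric for `q ≡ 1`
modulo 4. -/
theorem paleyConference_transpose :
    (paleyConference F)ᵀ = quadraticChar F (-1) • paleyConference F := by
  ext i j
  rcases i with _ | i <;> rcases j with _ | j
  · simp [paleyConference]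
  · simp [paleyConference]
  · simp [paleyConference, -quadraticChar_apply, quadraticChar_neg_one_mul_self]
  · simp [paleyConference, -quadraticChar_apply, ← map_mul]

theorem paleyConference_apply_self (i : Option F) : paleyConference F i i = 0 := by
  rcases i with _ | i <;> simp [paleyConference]

theorem paleyConference_apply_of_ne {i j : Option F} (h : i ≠ j) :
    paleyConference F i j = 1 ∨ paleyConference F i j = -1 := by
  rcases i with _ | i <;> rcases j with _ | j
  · simp at h
  · simp [paleyConference]
  · exact quadraticChar_dichotomy (by simp)
  · exact quadraticChar_dichotomy (sub_ne_zero.mpr (by simpa using h))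

omit [DecidableEq F] in
theorem ringChar_ne_two_of_odd_card (h : Fintype.card F % 2 = 1) : ringChar F ≠ 2 := by
  intro h2
  rw [FiniteField.even_card_of_char_two h2] at h
  simp at h

variable (F) in
theorem quadraticChar_neg_one_of_card_mod_four_eq_three (h : Fintype.card F % 4 = 3) :
    quadraticChar F (-1) = -1 := by
  rw [quadraticChar_neg_one_iff_not_isSquare, FiniteField.isSquare_neg_one_iff]
  simpa using h

variable (F) in
theorem quadraticChar_neg_one_of_card_mod_four_eq_one (h : Fintype.card F % 4 = 1) :
    quadraticChar F (-1) = 1 := by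
  rw [quadraticChar_one_iff_isSquare (by simp), FiniteField.isSquare_neg_one_iff]
  omega

variable (F) in
/-- Paley's first construction. -/
theorem hadamardExists_card_add_one (h : Fintype.card F % 4 = 3) :
    HadamardExists (Fintype.card F + 1) := by
  have hF := ringChar_ne_two_of_odd_card (F := F) (by omega)
  have hC := paleyConference_mul_transpose hF
  have hT := paleyConference_transpose (F := F)
  rw [quadraticChar_neg_one_of_card_mod_four_eq_three F h] at hT
  -- `(1 + C)(1 + Cᵀ) = 1 + C + Cᵀ + C Cᵀ`, and skewness cancels the middle terms.
  refine (IsHadamard.of_entries (M := 1 + paleyConference F) ?_ ?_).hadamardExists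
    (by simp)
  · intro i j
    rcases eq_or_ne i j with rfl | hij
    · simp [paleyConference_apply_self]
    · simpa [hij] using paleyConference_apply_of_ne hij
  · rw [transpose_add, transpose_one, mul_add, add_mul, add_mul, hC, hT]
    simp [add_smul, add_comm]

variable (F) in
/-- Paley's second construction. -/
theorem hadamardExists_two_mul_card_add_one (h : Fintype.card F % 4 = 1) :
    HadamardExists (2 * (Fintype.card F + 1)) := by
  have hF := ringChar_ne_two_of_odd_card (F := F) (by omega)
  have hC := paleyConference_mul_transpose hF
  have hT := paleyConference_transpose (F := F)
  rw [quadraticChar_neg_one_of_card_mod_four_eq_one F h, one_smul] at hT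
  rw [hT] at hC
  set C := paleyConference F with hCdef
  -- With `C` symmetric and `C² = q`, the diagonal blocks of the product are `(C + 1)² + (C - 1)² =
  -- 2 (q + 1)` and the others cancel. The summands `±1` fill the zero diagonal of `C`.
  refine (IsHadamard.of_entries
    (M := fromBlocks (C + 1) (C - 1) (C - 1) (-C - 1)) ?_ ?_).hadamardExists
    (by simp; ring)
  · rintro (i | i) (j | j) <;> rcases eq_or_ne i j with rfl | hij <;>
    first
    | (simp [hCdef, paleyConference_apply_self]; done)
    | rcases paleyConference_apply_of_ne hij with h | h <;>
      simp [hCdef, one_apply_ne hij, h]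
  · rw [fromBlocks_transpose, fromBlocks_multiply, ← fromBlocks_one, fromBlocks_smul]
    simp only [transpose_add, transpose_sub, transpose_neg, hT, transpose_one, Fintype.card_sum,
      Fintype.card_option]
    congr 1
    · noncomm_ring
      rw [hC]; simp only [zsmul_eq_mul, mul_one]; push_cast; noncomm_ring; simp
    · noncomm_ring
    · noncomm_ring
    · noncomm_ring
      rw [hC]; simp only [zsmul_eq_mul, mul_one]; push_cast; noncomm_ring; simp

variable (F) in
/-- From the skew Paley matrices of orders `q` and `q + 1`: a Hadamard matrix of order
`q * (q + 1)`. -/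
theorem hadamardExists_card_mul_card_add_one (h : Fintype.card F % 4 = 3) :
    HadamardExists (Fintype.card F * (Fintype.card F + 1)) := by
  have hF := ringChar_ne_two_of_odd_card (F := F) (by omega)
  have hC := paleyConference_mul_transpose hF
  have hT := paleyConference_transpose (F := F)
  have hε := quadraticChar_neg_one_of_card_mod_four_eq_three F h
  rw [hε] at hT
  set C := paleyConference F with hCdef
  let J : Matrix F F ℤ := of fun _ _ => 1
  let R : Matrix F F ℤ := of fun i j => (if i = j then 1 else 0) + quadraticChar F (i - j)
  have hJT : Jᵀ = J := rfl
  have hneg : ∀ i j : F, quadraticChar F (i - j) = -quadraticChar F (j - i) := by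
    intro i j
    rw [← neg_one_mul, ← hε, ← map_mul]; simp
  have hJJ : J * J = (Fintype.card F : ℤ) • J := by
    ext i j; simp [J, mul_apply]
  have hRJ : R * J = J := by
    ext i j
    simp [J, R, mul_apply, Finset.sum_add_distrib, -quadraticChar_apply, sum_quadraticChar_sub hF]
  have hJR : J * Rᵀ = J := by
    rw [← hJT, ← transpose_mul, hRJ]
  have hRR : R * Rᵀ = ((Fintype.card F : ℤ) + 1) • 1 - J := by
    ext i j
    simp only [R, J, mul_apply, transpose_apply, of_apply, add_mul, mul_add,
      Finset.sum_add_distrib, sub_apply, smul_apply]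
    rcases eq_or_ne i j with rfl | hij
    · have h0 : quadraticChar F 0 = 0 := quadraticChar_zero
      simp [sum_quadraticChar_mul_self, h0, -quadraticChar_apply]
    · simp [sum_quadraticChar_mul_quadraticChar hF hij, hij, -quadraticChar_apply]
      rw [hneg i j]; ring
  -- The cross terms of the product add up to `(C + Cᵀ) ⊗ J = 0`. The remaining ones are `1 ⊗ q J`
  -- and `q ⊗ ((q + 1) - J)`, where the multiples of `J` cancel.
  refine (IsHadamard.of_entries (M := (1 : Matrix (Option F) (Option F) ℤ) ⊗ₖ J + C ⊗ₖ R)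
    ?_ ?_).hadamardExists (by simp; ring)
  · rintro ⟨i, i'⟩ ⟨j, j'⟩
    have hR : R i' j' = 1 ∨ R i' j' = -1 := by
      rcases eq_or_ne i' j' with rfl | hij
      · simp [R]
      · simpa [R, hij] using quadraticChar_dichotomy (sub_ne_zero.mpr hij)
    rcases eq_or_ne i j with rfl | hij
    · simp [hCdef, paleyConference_apply_self, J]
    · rcases paleyConference_apply_of_ne hij with h | h <;> rcases hR with h' | h' <;>
        simp [hCdef, hij, h, h']
  · have e : ((1 : Matrix (Option F) (Option F) ℤ) ⊗ₖ J + C ⊗ₖ R)ᵀ = 1 ⊗ₖ J + Cᵀ ⊗ₖ Rᵀ := by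
      rw [transpose_add, ← kroneckerMap_transpose, ← kroneckerMap_transpose, transpose_one, hJT]
    rw [e, mul_add, add_mul, add_mul, ← mul_kronecker_mul, ← mul_kronecker_mul,
      ← mul_kronecker_mul, ← mul_kronecker_mul, hJJ, hRJ, hJR, hRR, hC, hT]
    ext ⟨i, i'⟩ ⟨j, j'⟩
    simp only [add_apply, kronecker_apply, smul_apply, sub_apply]
    by_cases hi : i = j <;> by_cases hi' : i' = j' <;>
      (simp [one_apply, hi, hi', J]; try ring)

end Paley

/-! ### The Goethals–Seidel array. -/

section GoethalsSeidel

variable {G : Type*} [AddCommGroup G] [Fintype G] [DecidableEq G]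

/-- The array of Goethals and Seidel: four circulant matrices with entries `±1` and
`A Aᵀ + B Bᵀ + C Cᵀ + D Dᵀ = 4 n` give a Hadamard matrix of order `4 n`. -/
theorem hadamardExists_of_circulant (a b c d : G → ℤ)
    (ha : ∀ i, a i = 1 ∨ a i = -1) (hb : ∀ i, b i = 1 ∨ b i = -1)
    (hc : ∀ i, c i = 1 ∨ c i = -1) (hd : ∀ i, d i = 1 ∨ d i = -1)
    (h : circulant a * (circulant a)ᵀ + circulant b * (circulant b)ᵀ +
      circulant c * (circulant c)ᵀ + circulant d * (circulant d)ᵀ =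
        (4 * Fintype.card G : ℤ) • 1) :
    HadamardExists (4 * Fintype.card G) := by
  -- `R` permutes by `i ↦ -i` and conjugates every circulant into its transpose. As circulants
  -- commute, the off-diagonal blocks of the product cancel in pairs.
  let R : Matrix G G ℤ := of fun i j => if i + j = 0 then 1 else 0
  have mulR (X : Matrix G G ℤ) (i j : G) : (X * R) i j = X i (-j) := by
    simp [mul_apply, R, add_eq_zero_iff_eq_neg]
  have hRT : Rᵀ = R := by ext i j; simp [R, add_comm]
  have hRR : R * R = 1 := by
    ext i j; rw [mulR]; simp [R, one_apply, add_neg_eq_zero]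
  have hR (v : G → ℤ) : R * circulant v = circulant (fun i => v (-i)) * R := by
    ext i j
    rw [mulR]
    simp [mul_apply, R, add_eq_zero_iff_neg_eq, sub_eq_add_neg, add_comm]
  have hRX (v : G → ℤ) (X : Matrix G G ℤ) :
      R * (circulant v * X) = circulant (fun i => v (-i)) * (R * X) := by
    rw [← mul_assoc, hR, mul_assoc]
  have hcomm (v w : G → ℤ) := circulant_mul_comm v w
  have hcommR (v w : G → ℤ) :
      circulant v * (circulant w * R) = circulant w * (circulant v * R) := by
    rw [← mul_assoc, hcomm, mul_assoc]
  have entry {v : G → ℤ} (hv : ∀ i, v i = 1 ∨ v i = -1) (i j : G) :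
      (circulant v i j = 1 ∨ circulant v i j = -1) ∧
      ((circulant v * R) i j = 1 ∨ (circulant v * R) i j = -1) ∧
      (((circulant v)ᵀ * R) i j = 1 ∨ ((circulant v)ᵀ * R) i j = -1) := by
    rw [mulR, mulR]
    exact ⟨hv _, hv _, hv _⟩
  set A := circulant a with hA
  set B := circulant b with hB
  set C := circulant c with hC
  set D := circulant d with hD
  have neg_entry {x : ℤ} (h : x = 1 ∨ x = -1) : -x = 1 ∨ -x = -1 := by omega
  refine (IsHadamard.of_entries
    (M := fromBlocks (fromBlocks A (B * R) (-(B * R)) A)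
      (fromBlocks (C * R) (D * R) (Dᵀ * R) (-(Cᵀ * R)))
      (fromBlocks (-(C * R)) (-(Dᵀ * R)) (-(D * R)) (Cᵀ * R))
      (fromBlocks A (Bᵀ * R) (-(Bᵀ * R)) A)) ?_ ?_).hadamardExists
    (by simp; ring)
  · rintro ((i | i) | (i | i)) ((j | j) | (j | j)) <;>
      first
      | exact (entry ha i j).1
      | exact (entry hb i j).2.1
      | exact (entry hb i j).2.2
      | exact (entry hc i j).2.1
      | exact (entry hc i j).2.2
      | exact (entry hd i j).2.1
      | exact (entry hd i j).2.2
      | exact neg_entry (entry hb i j).2.1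
      | exact neg_entry (entry hb i j).2.2
      | exact neg_entry (entry hc i j).2.1
      | exact neg_entry (entry hc i j).2.2
      | exact neg_entry (entry hd i j).2.1
      | exact neg_entry (entry hd i j).2.2
  · have hn : (Fintype.card ((G ⊕ G) ⊕ (G ⊕ G)) : ℤ) = 4 * Fintype.card G := by
      simp; ring
    rw [hn, ← fromBlocks_one, ← fromBlocks_one, fromBlocks_smul, fromBlocks_smul, ← h]
    simp only [fromBlocks_transpose, fromBlocks_multiply, fromBlocks_add, transpose_neg,
      transpose_mul, hRT, transpose_transpose]
    simp only [smul_zero]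
    simp only [hA, hB, hC, hD, transpose_circulant, ← fromBlocks_zero, mul_neg, neg_mul, neg_neg, mul_assoc, hR, hRX, hRR, mul_one]
    congr 1
    all_goals congr 1
    all_goals try simp only [hcomm, hcommR]
    all_goals abel

omit [DecidableEq G] in
theorem circulant_sub_right_mul_transpose (g : G → ℤ) (c : G) :
    circulant (fun i => g (i - c)) * (circulant fun i => g (i - c))ᵀ =
      circulant g * (circulant g)ᵀ := by
  ext i j
  simp only [mul_apply, transpose_apply, circulant_apply]
  refine Fintype.sum_equiv (Equiv.addRight c) _ _ fun l => ?_
  simp only [Equiv.coe_addRight, sub_sub]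

end GoethalsSeidel

/-! ### Golay pairs and the orders `4 (2 ^ h + 1)`. -/

section Golay

/-- Golay complementary pairs of length `2 ^ k`, padded with zeros. -/
theorem exists_golay_pair (n : ℕ) [NeZero n] (k : ℕ) (hk : 2 ^ k ≤ n) :
    ∃ f g : ZMod n → ℤ,
      (∀ i, i.val < 2 ^ k → (f i = 1 ∨ f i = -1) ∧ (g i = 1 ∨ g i = -1)) ∧
      (∀ i, 2 ^ k ≤ i.val → f i = 0 ∧ g i = 0) ∧
      circulant f * (circulant f)ᵀ + circulant g * (circulant g)ᵀ = (2 ^ (k + 1) : ℤ) • 1 := by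
  induction k with
  | zero =>
    refine ⟨Pi.single 0 1, Pi.single 0 1, ?_, ?_, ?_⟩
    · intro i hi
      have : i = 0 := by rw [← ZMod.val_eq_zero]; simpa using hi
      simp [this]
    · intro i hi
      have : i ≠ 0 := by rintro rfl; simp at hi
      simp [this]
    · simp only [circulant_single_one, transpose_one, mul_one]
      module
  | succ k ih =>
    have hk' : 2 ^ k + 2 ^ k ≤ n := by rwa [← two_mul, ← pow_succ']
    have hpos : 0 < 2 ^ k := by positivity
    obtain ⟨f, g, h1, h0, h⟩ := ih (by omega)
    let c : ZMod n := ((2 ^ k : ℕ) : ZMod n)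
    have hc : c.val = 2 ^ k := ZMod.val_natCast_of_lt (by omega)
    have sub_val (i : ZMod n) : (i.val < 2 ^ k → 2 ^ k ≤ (i - c).val) ∧
        (2 ^ k ≤ i.val → (i - c).val = i.val - 2 ^ k) := by
      constructor
      · intro hi
        -- Here the shift wraps around, landing beyond the support because two blocks of length `2 ^
        -- k` fit into `n`.
        have e : (i - c) = ((n + i.val - 2 ^ k : ℕ) : ZMod n) := by
          rw [Nat.cast_sub (by omega)]
          simp [c]
        rw [e, ZMod.val_natCast_of_lt (by omega)]
        omega
      · intro hi
        rw [ZMod.val_sub (by omega), hc]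
    -- Golay's doubling: append `g` and `-g` to `f`. The supports are disjoint, so the entries
    -- remain `±1`, and shifting `g` preserves its autocorrelation.
    refine ⟨f + fun i => g (i - c), f - fun i => g (i - c), ?_, ?_, ?_⟩
    · intro i hi
      rw [pow_succ] at hi
      rcases lt_or_ge i.val (2 ^ k) with hlt | hge
      · simpa [(h0 _ ((sub_val i).1 hlt)).2] using (h1 i hlt).1
      · have hv := (sub_val i).2 hge
        have := (h1 (i - c) (by omega)).2
        simp only [Pi.add_apply, Pi.sub_apply, (h0 i hge).1]
        omega
    · intro i hi
      rw [pow_succ] at hi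
      have hv := (sub_val i).2 (by omega)
      simp [(h0 i (by omega)).1, (h0 (i - c) (by omega)).2]
    · have hs := circulant_sub_right_mul_transpose g c
      rw [circulant_add, circulant_sub, transpose_add, transpose_sub]
      set X := circulant f
      set Y := circulant fun i => g (i - c)
      have e : (X + Y) * (Xᵀ + Yᵀ) + (X - Y) * (Xᵀ - Yᵀ) =
          (2 : ℤ) • (X * Xᵀ + Y * Yᵀ) := by
        noncomm_ring
      rw [e, hs, h, smul_smul, pow_succ' _ (k + 1)]

/-- A Golay pair of length `2 ^ h` leaves one free position, filled by the unit vector `e`. The four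
sequences `e ± f`, `e ± g` have entries `±1`, and their circulants give `4 E Eᵀ + 2 (X Xᵀ + Y Yᵀ) =
4 (1 + 2 ^ h)`. -/
theorem hadamardExists_four_mul_two_pow_add_one (h : ℕ) :
    HadamardExists (4 * (2 ^ h + 1)) := by
  have : NeZero (2 ^ h + 1) := ⟨by positivity⟩
  obtain ⟨f, g, h1, h0, hfg⟩ := exists_golay_pair (2 ^ h + 1) h (by omega)
  let c : ZMod (2 ^ h + 1) := ((2 ^ h : ℕ) : ZMod (2 ^ h + 1))
  have hc : c.val = 2 ^ h := ZMod.val_natCast_of_lt (by omega)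
  let e : ZMod (2 ^ h + 1) → ℤ := Pi.single c 1
  have heC (i : ZMod (2 ^ h + 1)) (hi : i.val < 2 ^ h) : e i = 0 := by
    have : i ≠ c := by rintro rfl; omega
    simp [e, this]
  have heq (i : ZMod (2 ^ h + 1)) (hi : 2 ^ h ≤ i.val) : e i = 1 := by
    have hlt := ZMod.val_lt i
    have : i = c := ZMod.val_injective _ (by omega)
    simp [e, this]
  have key (v : ZMod (2 ^ h + 1) → ℤ) (hv1 : ∀ i, i.val < 2 ^ h → v i = 1 ∨ v i = -1)
      (hv0 : ∀ i, 2 ^ h ≤ i.val → v i = 0) (i : ZMod (2 ^ h + 1)) :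
      ((e + v) i = 1 ∨ (e + v) i = -1) ∧ ((e - v) i = 1 ∨ (e - v) i = -1) := by
    simp only [Pi.add_apply, Pi.sub_apply]
    rcases lt_or_ge i.val (2 ^ h) with hlt | hge
    · have := hv1 i hlt
      rw [heC i hlt]; omega
    · rw [heq i hge, hv0 i hge]; simp
  have hee : circulant e * (circulant e)ᵀ = 1 := by
    have := circulant_sub_right_mul_transpose (Pi.single 0 1 : ZMod (2 ^ h + 1) → ℤ) c
    rw [circulant_single_one, transpose_one, mul_one] at this
    rw [← this]
    have he : e = fun i => (Pi.single 0 1 : ZMod (2 ^ h + 1) → ℤ) (i - c) := by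
      ext i; simp [e, Pi.single_apply, sub_eq_zero]
    rw [he]
  have hf := key f (fun i hi => (h1 i hi).1) (fun i hi => (h0 i hi).1)
  have hg := key g (fun i hi => (h1 i hi).2) (fun i hi => (h0 i hi).2)
  have := hadamardExists_of_circulant (e + f) (e - f) (e + g) (e - g)
    (fun i => (hf i).1) (fun i => (hf i).2) (fun i => (hg i).1) (fun i => (hg i).2) (by
      simp only [circulant_add, circulant_sub, transpose_add, transpose_sub]
      set E := circulant e
      set X := circulant f
      set Y := circulant g
      have e4 : (E + X) * (Eᵀ + Xᵀ) + (E - X) * (Eᵀ - Xᵀ) + (E + Y) * (Eᵀ + Yᵀ) +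
          (E - Y) * (Eᵀ - Yᵀ) = (4 : ℤ) • (E * Eᵀ) + (2 : ℤ) • (X * Xᵀ + Y * Yᵀ) := by
        noncomm_ring
      rw [e4, hee, hfg, smul_smul, ← add_smul, ZMod.card]
      congr 1
      push_cast; ring)
  rwa [ZMod.card] at this

end Golay

/-! ### Existence for the listed Hadamard orders. -/

theorem exists_finite_field_of_isPrimePow {q : ℕ} (hq : IsPrimePow q) :
    ∃ (F : Type) (_ : Field F) (_ : Fintype F), Fintype.card F = q := by
  obtain ⟨p, k, hp, hk, rfl⟩ := hq
  have : Fact p.Prime := ⟨hp.nat_prime⟩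
  have := Fintype.ofFinite (GaloisField p k)
  exact ⟨GaloisField p k, inferInstance, inferInstance, by
    rw [← Nat.card_eq_fintype_card, GaloisField.card p k hk.ne']⟩

theorem hadamardExists_of_mod_four_eq_three {q : ℕ} (h : q % 4 = 3) (hq : IsPrimePow q) :
    HadamardExists (q + 1) ∧ HadamardExists (q * (q + 1)) := by
  classical
  obtain ⟨F, _, _, rfl⟩ := exists_finite_field_of_isPrimePow hq
  exact ⟨hadamardExists_card_add_one F h, hadamardExists_card_mul_card_add_one F h⟩

theorem hadamardExists_of_mod_four_eq_one {q : ℕ} (h : q % 4 = 1) (hq : IsPrimePow q) :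
    HadamardExists (2 * (q + 1)) := by
  classical
  obtain ⟨F, _, _, rfl⟩ := exists_finite_field_of_isPrimePow hq
  exact hadamardExists_two_mul_card_add_one F h

/-- For odd `q`, the residue of `q ^ h` modulo 4 selects one of Paley's constructions, followed by
doubling. Characteristic 2 is out of their reach and needs the Golay pairs. -/
theorem hadamardExists_four_mul_prime_pow_add_one {q h : ℕ} (hq : q.Prime) (hh : 1 ≤ h) :
    HadamardExists (4 * (q ^ h + 1)) := by
  have hpp : IsPrimePow (q ^ h) := hq.isPrimePow.pow (by omega)
  rcases hq.eq_two_or_odd with rfl | hodd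
  · exact hadamardExists_four_mul_two_pow_add_one h
  · have h2 : q ^ h % 2 = 1 := by simp [Nat.pow_mod, hodd]
    rcases (by omega : q ^ h % 4 = 1 ∨ q ^ h % 4 = 3) with h4 | h4
    · have := hadamardExists_two.mul (hadamardExists_of_mod_four_eq_one h4 hpp)
      rwa [← mul_assoc] at this
    · exact (hadamardExists_two_pow 2).mul (hadamardExists_of_mod_four_eq_three h4 hpp).1

theorem hadamardExists_of_mem_hadamardOrders {n : ℕ} (hn : n ∈ hadamardOrders) :
    HadamardExists n := by
  rcases hn with ⟨p, -, rfl⟩ | ⟨p, h, q, hp, hh, hq, rfl⟩ | ⟨p, q, -, h4, hq, rfl⟩ |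
    ⟨q, h4, hq, rfl⟩ | ⟨q, h4, hq, rfl⟩
  · exact hadamardExists_two_pow p
  · obtain ⟨r, rfl⟩ := Nat.exists_eq_add_of_le' hp
    have := (hadamardExists_two_pow r).mul (hadamardExists_four_mul_prime_pow_add_one hq hh)
    rwa [← mul_assoc, show 2 ^ r * 4 = 2 ^ (r + 2) by rw [pow_add]; rfl] at this
  · have := (hadamardExists_two_pow p).mul
      (hadamardExists_of_mod_four_eq_three h4 hq.isPrimePow).2
    rwa [← mul_assoc] at this
  · exact (hadamardExists_of_mod_four_eq_three h4 hq).1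
  · exact hadamardExists_of_mod_four_eq_one h4 hq

end Matrix

/-! ### Bounds on the number of orthogonal sign rows. -/

/-- Pairwise orthogonal rows with entries `±1`. -/
structure Matrix.OrthogonalSigns {κ : Type*} {s : ℕ} (r : Matrix κ (Fin s) ℤ) : Prop where
  entry : ∀ i j, r i j = 1 ∨ r i j = -1
  orthogonal : ∀ i i', i ≠ i' → ∑ j, r i j * r i' j = 0

namespace Matrix.OrthogonalSigns

variable {κ : Type*} {s : ℕ} {r : Matrix κ (Fin s) ℤ}

theorem mul_self (h : r.OrthogonalSigns) (i : κ) (j : Fin s) : r i j * r i j = 1 := by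
  rcases h.entry i j with h | h <;> simp [h]

theorem mul_transpose [DecidableEq κ] (h : r.OrthogonalSigns) : r * rᵀ = (s : ℤ) • 1 := by
  ext i i'
  rw [smul_apply]
  rcases eq_or_ne i i' with rfl | hi
  · simp [mul_apply, h.mul_self]
  · simp [mul_apply, h.orthogonal _ _ hi, hi]

/-- Each `r i j * r i' j + 1` is even, and by orthogonality these add up to `s`. -/
theorem even (h : r.OrthogonalSigns) {i i' : κ} (hi : i ≠ i') : Even s := by
  have h0 := h.orthogonal i i' hi
  have h2 : (2 : ℤ) ∣ ∑ j, (r i j * r i' j + 1) := Finset.dvd_sum fun j _ => by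
    rcases h.entry i j with h1 | h1 <;> rcases h.entry i' j with h2 | h2 <;> simp [h1, h2]
  rw [Finset.sum_add_distrib, h0] at h2
  simp only [Finset.sum_const, Finset.card_univ, Fintype.card_fin, zero_add, nsmul_eq_mul,
    mul_one] at h2
  exact even_iff_two_dvd.mpr (by exact_mod_cast h2)

/-- For three rows `x, y, z`, the factors of `(x + y)(x + z)` are even in each column, while the sum
over the columns is `s` by orthogonality. -/
theorem four_dvd (h : r.OrthogonalSigns) {i j k : κ} (hij : i ≠ j) (hik : i ≠ k) (hjk : j ≠ k) :
    4 ∣ s := by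
  have h4 : (4 : ℤ) ∣ ∑ t, (r i t + r j t) * (r i t + r k t) := Finset.dvd_sum fun t _ => by
    rcases h.entry i t with h1 | h1 <;> rcases h.entry j t with h2 | h2 <;>
      rcases h.entry k t with h3 | h3 <;> simp [h1, h2, h3]
  simp only [add_mul, mul_add, Finset.sum_add_distrib, h.mul_self, h.orthogonal _ _ hik,
    h.orthogonal _ _ hij.symm, h.orthogonal _ _ hjk] at h4
  simp only [Finset.sum_const, Finset.card_univ, Fintype.card_fin, nsmul_eq_mul, mul_one,
    add_zero] at h4
  exact_mod_cast h4

/-- Over `ℚ`, the invertible matrix `r rᵀ = s I` has rank equal to the number of rows, while `r` has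
only `s` columns. -/
theorem card_le [Fintype κ] (h : r.OrthogonalSigns) (hs : s ≠ 0) : Fintype.card κ ≤ s := by
  classical
  have hR : (r.map (Int.cast : ℤ → ℚ)) * (r.map (Int.cast : ℤ → ℚ))ᵀ = (s : ℚ) • 1 := by
    ext i i'
    have := congrArg (Int.cast : ℤ → ℚ) (congrFun (congrFun h.mul_transpose i) i')
    rw [smul_apply] at this ⊢
    rcases eq_or_ne i i' with rfl | hi
    · simpa [mul_apply] using this
    · simpa [mul_apply, hi] using this
  have h1 : ((s : ℚ) • (1 : Matrix κ κ ℚ)).rank = Fintype.card κ := by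
    apply rank_of_isUnit
    rw [isUnit_iff_isUnit_det, det_smul, det_one, mul_one]
    exact (IsUnit.mk0 _ (by exact_mod_cast hs)).pow _
  rw [← h1, ← hR]
  exact (rank_mul_le_left _ _).trans ((rank_le_card_width _).trans (by simp))

theorem transpose_mul {r : Matrix (Fin s) (Fin s) ℤ} (h : r.OrthogonalSigns) :
    rᵀ * r = (s : ℤ) • 1 := by
  simpa using (IsHadamard.of_entries h.entry (by simpa using h.mul_transpose)).conjTranspose_mul

end Matrix.OrthogonalSigns

theorem Matrix.orthogonalSigns_one (s : ℕ) :
    (Matrix.of fun _ _ => 1 : Matrix (Fin 1) (Fin s) ℤ).OrthogonalSigns :=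
  ⟨by simp, fun i i' h => (h (Subsingleton.elim _ _)).elim⟩

theorem Matrix.HadamardExists.orthogonalSigns {s : ℕ} (hs : HadamardExists s) :
    ∃ r : Matrix (Fin s) (Fin s) ℤ, r.OrthogonalSigns := by
  obtain ⟨M, hM⟩ := hs
  refine ⟨M, fun i j => Unitary.mem_iff_eq_one_or_eq_neg_one.mp (hM.apply_mem i j), ?_⟩
  intro i i' hi
  simpa [mul_apply, hi] using congrFun (congrFun hM.mul_conjTranspose i) i'

theorem Matrix.exists_orthogonalSigns_two {s : ℕ} (hs : Even s) :
    ∃ r : Matrix (Fin 2) (Fin s) ℤ, r.OrthogonalSigns := by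
  obtain ⟨m, rfl⟩ := hs
  have h : ∑ j : Fin (m + m), (if (j : ℕ) < m then (-1 : ℤ) else 1) = 0 := by
    rw [Fin.sum_univ_add]; simp
  refine ⟨of ![fun j => if (j : ℕ) < m then -1 else 1, fun _ => 1], ?_, ?_⟩
  · intro i j
    by_cases h : (j : ℕ) < m <;> fin_cases i <;> simp [h]
  · intro i i' hi
    fin_cases i <;> fin_cases i' <;> simp_all

/-! ### Adjacency matrices, switching and walks of length two. -/

namespace SignedGraph

variable {V W : Type*} (G : SignedGraph V)

theorem negAdj_adj {G : SignedGraph V} {u v : V} (h : G.NegAdj u v) : G.graph.Adj u v :=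
  G.neg_subset h

theorem adjMatrix_congr {G : SignedGraph V} {K : SignedGraph W} {u v : V} {u' v' : W}
    (hP : G.PosAdj u v ↔ K.PosAdj u' v') (hN : G.NegAdj u v ↔ K.NegAdj u' v') :
    G.adjMatrix u v = K.adjMatrix u' v' := by
  by_cases h1 : G.PosAdj u v <;> by_cases h2 : G.NegAdj u v <;>
    simp [adjMatrix, h1, h2, ← hP, ← hN]

theorem adjMatrix_comm (u v : V) : G.adjMatrix u v = G.adjMatrix v u :=
  adjMatrix_congr (by rw [PosAdj, PosAdj, G.graph.adj_comm, Sym2.eq_swap])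
    (by rw [NegAdj, NegAdj, Sym2.eq_swap])

theorem adjMatrix_of_posAdj {u v : V} (h : G.PosAdj u v) : G.adjMatrix u v = 1 := by
  simp [adjMatrix, h]

theorem adjMatrix_of_negAdj {u v : V} (h : G.NegAdj u v) : G.adjMatrix u v = -1 := by
  have : ¬ G.PosAdj u v := fun h' => h'.2 h
  simp [adjMatrix, h, this]

theorem adjMatrix_of_not_adj {u v : V} (h : ¬ G.graph.Adj u v) : G.adjMatrix u v = 0 := by
  have h1 : ¬ G.PosAdj u v := fun h' => h h'.1
  have h2 : ¬ G.NegAdj u v := fun h' => h (negAdj_adj h')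
  simp [adjMatrix, h1, h2]

theorem adj_cases (u v : V) :
    (G.PosAdj u v ∧ ¬ G.NegAdj u v ∧ G.adjMatrix u v = 1) ∨
    (G.NegAdj u v ∧ ¬ G.PosAdj u v ∧ G.adjMatrix u v = -1) ∨
    (¬ G.graph.Adj u v ∧ ¬ G.NegAdj u v ∧ ¬ G.PosAdj u v ∧ G.adjMatrix u v = 0) := by
  by_cases h : G.graph.Adj u v
  · by_cases h' : G.NegAdj u v
    · exact Or.inr (Or.inl ⟨h', fun h'' => h''.2 h', G.adjMatrix_of_negAdj h'⟩)
    · exact Or.inl ⟨⟨h, h'⟩, h', G.adjMatrix_of_posAdj ⟨h, h'⟩⟩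
  · exact Or.inr (Or.inr ⟨h, fun h' => h (negAdj_adj h'), fun h' => h h'.1,
      G.adjMatrix_of_not_adj h⟩)

theorem adjMatrix_ne_zero_iff (u v : V) : G.adjMatrix u v ≠ 0 ↔ G.graph.Adj u v := by
  rcases G.adj_cases u v with ⟨h, -, h'⟩ | ⟨h, -, h'⟩ | ⟨h, -, -, h'⟩
  · simp [h', h.1]
  · simp [h', negAdj_adj h]
  · simp [h', h]

theorem adjMatrix_induce (t : Set V) (u v : t) :
    (G.induce t).adjMatrix u v = G.adjMatrix u v :=
  adjMatrix_congr Iff.rfl Iff.rfl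

theorem adjMatrix_eq_zero_of_isTotallyDisconnected {G : SignedGraph V}
    (h : G.IsTotallyDisconnected) : G.adjMatrix = 0 := by
  ext u v
  apply G.adjMatrix_of_not_adj
  rw [show G.graph = ⊥ from h]
  simp

/-- The signed graph with a given symmetric adjacency matrix with entries `0`, `1`, `-1`. -/
def ofMatrix (M : Matrix V V ℝ) (hM : M.IsSymm) (hdiag : ∀ v, M v v = 0) : SignedGraph V where
  graph :=
    { Adj := fun u v => M u v ≠ 0
      symm := ⟨fun u v h => by rwa [hM.apply]⟩
      loopless := ⟨fun v h => h (hdiag v)⟩ }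
  neg := {e | ∃ u v, e = s(u, v) ∧ M u v = -1}
  neg_subset := by
    rintro e ⟨u, v, rfl, h⟩
    simp [h]

theorem adjMatrix_ofMatrix (M : Matrix V V ℝ) (hM : M.IsSymm) (hdiag : ∀ v, M v v = 0)
    (hentry : ∀ u v, M u v = 0 ∨ M u v = 1 ∨ M u v = -1) :
    (ofMatrix M hM hdiag).adjMatrix = M := by
  have hneg (u v : V) : (ofMatrix M hM hdiag).NegAdj u v ↔ M u v = -1 := by
    constructor
    · rintro ⟨a, b, hab, h⟩
      rcases Sym2.eq_iff.mp hab with ⟨rfl, rfl⟩ | ⟨rfl, rfl⟩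
      · exact h
      · rwa [hM.apply]
    · exact fun h => ⟨u, v, rfl, h⟩
  ext u v
  rcases hentry u v with h | h | h
  · rw [h, adjMatrix_of_not_adj]
    exact fun h' => h' h
  · rw [h, adjMatrix_of_posAdj]
    refine ⟨?_, fun h' => ?_⟩
    · change M u v ≠ 0
      simp [h]
    · have := (hneg u v).mp h'
      rw [h] at this; norm_num at this
  · rw [h, adjMatrix_of_negAdj _ ((hneg u v).mpr h)]

theorem adjMatrix_entry (u v : V) :
    G.adjMatrix u v = 0 ∨ G.adjMatrix u v = 1 ∨ G.adjMatrix u v = -1 := by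
  rcases G.adj_cases u v with h | h | h <;> tauto

theorem switchingIsomorphic_of_equiv {G₁ : SignedGraph V} {G₂ : SignedGraph W} (e : V ≃ W)
    (d : V → ℝ) (hd : ∀ v, d v = 1 ∨ d v = -1)
    (h : ∀ u v, G₂.adjMatrix (e u) (e v) = d u * G₁.adjMatrix u v * d v) :
    G₁.SwitchingIsomorphic G₂ := by
  let M : Matrix W W ℝ := G₁.adjMatrix.submatrix e.symm e.symm
  have hM : M.IsSymm := by ext u v; exact G₁.adjMatrix_comm _ _
  have hdiag (w : W) : M w w = 0 := G₁.adjMatrix_of_not_adj (SimpleGraph.irrefl _)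
  have hK := adjMatrix_ofMatrix M hM hdiag fun u v => G₁.adjMatrix_entry _ _
  refine ⟨ofMatrix M hM hdiag, ⟨e, ?_⟩, fun w => d (e.symm w), fun w => hd _, fun u v => ?_⟩
  · rw [hK]; ext u v; simp [M]
  · have h' := h (e.symm u) (e.symm v)
    rw [e.apply_symm_apply, e.apply_symm_apply] at h'
    rw [hK, h']
    rcases hd (e.symm u) with h1 | h1 <;> simp [h1, M]

theorem switchingIsomorphic_refl : G.SwitchingIsomorphic G :=
  switchingIsomorphic_of_equiv (Equiv.refl V) (fun _ => 1) (fun _ => Or.inl rfl) (by simp)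

/-- This reads `w₂` as an entry of `A²`, so that the SRG conditions become matrix identities. -/
theorem w₂_eq_sum [Fintype V] (u v : V) :
    (G.w₂ u v : ℝ) = ∑ x, G.adjMatrix u x * G.adjMatrix x v := by
  classical
  rw [w₂, Set.ncard_eq_toFinset_card', Set.ncard_eq_toFinset_card']
  simp only [Set.toFinset_ofPred, Finset.card_filter]
  push_cast
  rw [← Finset.sum_sub_distrib]
  refine Finset.sum_congr rfl fun x _ => ?_
  rcases G.adj_cases u x with ⟨h1, h2, h3⟩ | ⟨h1, h2, h3⟩ | ⟨-, h1, h2, h3⟩ <;>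
    rcases G.adj_cases x v with ⟨h1', h2', h3'⟩ | ⟨h1', h2', h3'⟩ | ⟨-, h1', h2', h3'⟩ <;>
    simp [h1, h2, h3, h1', h2', h3']

theorem not_isEigenvalue_of_adjMatrix_eq_zero [Fintype V] {μ : ℝ} (hμ : μ ≠ 0)
    (h : G.adjMatrix = 0) : ¬ G.IsEigenvalue μ := by
  intro hE
  obtain ⟨x, hx⟩ := hE.exists_hasEigenvector
  have h1 := hx.apply_eq_smul
  rw [h] at h1
  simp only [Matrix.mulVecLin_apply, Matrix.zero_mulVec] at h1
  exact (smul_ne_zero hμ hx.2) h1.symm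

/-! ### Star sets with an edgeless complement. -/

section StarSet

variable [Fintype V] {μ : ℝ} {S : Set V}

open Classical in
/-- The eigenvectors for `μ ≠ 0` are determined by their entries in `S`, when `G - S` has no
edges. -/
theorem mem_eigenspace_iff (hμ : μ ≠ 0) (hT : ∀ t ∉ S, ∀ t' ∉ S, G.adjMatrix t t' = 0)
    (x : V → ℝ) :
    x ∈ Module.End.eigenspace G.adjMatrix.mulVecLin μ ↔
      (∀ t ∉ S, x t = (∑ i, if i ∈ S then G.adjMatrix t i * x i else 0) / μ) ∧
      ∀ i ∈ S, ∑ v, G.adjMatrix i v * x v = μ * x i := by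
  have hsum (t : V) (ht : t ∉ S) :
      (∑ i, if i ∈ S then G.adjMatrix t i * x i else 0) = ∑ v, G.adjMatrix t v * x v := by
    refine Finset.sum_congr rfl fun v _ => ?_
    split_ifs with hv
    · rfl
    · rw [hT t ht v hv, zero_mul]
  rw [Module.End.mem_eigenspace_iff, funext_iff]
  simp only [Matrix.mulVecLin_apply, Matrix.mulVec, dotProduct, Pi.smul_apply, smul_eq_mul]
  constructor
  · intro h
    refine ⟨fun t ht => ?_, fun i _ => h i⟩
    rw [hsum t ht, h t, mul_div_cancel_left₀ _ hμ]
  · rintro ⟨h1, h2⟩ v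
    by_cases hv : v ∈ S
    · exact h2 v hv
    · rw [h1 v hv, hsum v hv, mul_div_cancel₀ _ hμ]

/-- Restriction of the eigenvectors for `μ` to `S`. -/
noncomputable def eigenspaceRestrict (μ : ℝ) (S : Set V) :
    Module.End.eigenspace G.adjMatrix.mulVecLin μ →ₗ[ℝ] (S → ℝ) :=
  LinearMap.funLeft ℝ ℝ ((↑) : S → V) ∘ₗ Submodule.subtype _

theorem eigenspaceRestrict_apply (x : Module.End.eigenspace G.adjMatrix.mulVecLin μ) (i : S) :
    G.eigenspaceRestrict μ S x i = x.1 i := rfl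

/-- The multiplicity of `μ` is thus at most `|S|`, and equality amounts to surjectivity of the
restriction. -/
theorem eigenspaceRestrict_injective (hμ : μ ≠ 0)
    (hT : ∀ t ∉ S, ∀ t' ∉ S, G.adjMatrix t t' = 0) :
    Function.Injective (G.eigenspaceRestrict μ S) := by
  classical
  rw [injective_iff_map_eq_zero]
  rintro ⟨x, hx⟩ h0
  have hS (i : V) (hi : i ∈ S) : x i = 0 := congrFun h0 ⟨i, hi⟩
  obtain ⟨h1, -⟩ := (G.mem_eigenspace_iff hμ hT x).mp hx
  ext v
  by_cases hv : v ∈ S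
  · exact hS v hv
  · change x v = 0
    rw [h1 v hv, Finset.sum_eq_zero, zero_div]
    intro i _
    split_ifs with hi
    · rw [hS i hi, mul_zero]
    · rfl

open Classical in
/-- The star set equation, when `G - S` has no edges. -/
theorem isStarSet_iff (hμ : μ ≠ 0) (hT : ∀ t ∉ S, ∀ t' ∉ S, G.adjMatrix t t' = 0)
    (hS : S.Nonempty) :
    G.IsStarSet μ S ↔ ∀ i ∈ S, ∀ i' ∈ S, (if i = i' then μ ^ 2 else 0) =
      μ * G.adjMatrix i i' + ∑ t, if t ∈ S then 0 else G.adjMatrix i t * G.adjMatrix t i' := by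
  have hinj := G.eigenspaceRestrict_injective hμ hT
  have hcard : Module.finrank ℝ (S → ℝ) = S.ncard := by
    rw [Module.finrank_fintype_fun_eq_card, ← Nat.card_coe_set_eq, Nat.card_eq_fintype_card]
  have hx (i' : V) (hi' : i' ∈ S) (x : V → ℝ) (hxS : ∀ i ∈ S, x i = if i = i' then 1 else 0) :
      x ∈ Module.End.eigenspace G.adjMatrix.mulVecLin μ ↔
        (∀ t ∉ S, x t = G.adjMatrix t i' / μ) ∧
        ∀ i ∈ S, ∑ v, G.adjMatrix i v * x v = μ * x i := by
    rw [G.mem_eigenspace_iff hμ hT]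
    have (t : V) : (∑ i, if i ∈ S then G.adjMatrix t i * x i else 0) = G.adjMatrix t i' := by
      rw [Finset.sum_eq_single i']
      · simp [hi', hxS i' hi']
      · intro i _ hne
        split_ifs with hi
        · simp [hxS i hi, hne]
        · rfl
      · simp
    simp only [this]
  have hrow (i i' : V) (hi' : i' ∈ S) (x : V → ℝ)
      (hxS : ∀ i ∈ S, x i = if i = i' then 1 else 0)
      (hxT : ∀ t ∉ S, x t = G.adjMatrix t i' / μ) :
      μ * ∑ v, G.adjMatrix i v * x v = μ * G.adjMatrix i i' +
        ∑ t, if t ∈ S then 0 else G.adjMatrix i t * G.adjMatrix t i' := by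
    have e (v : V) : G.adjMatrix i v * x v = (if v = i' then G.adjMatrix i i' else 0) +
        (if v ∈ S then 0 else G.adjMatrix i v * G.adjMatrix v i') / μ := by
      by_cases hv : v ∈ S
      · rw [hxS v hv]
        by_cases h : v = i' <;> simp [hv, h, hi']
      · have : v ≠ i' := fun h => hv (h ▸ hi')
        rw [hxT v hv]
        simp [hv, this, mul_div_assoc]
    simp only [e, Finset.sum_add_distrib, ← Finset.sum_div, Finset.sum_ite_eq', Finset.mem_univ,
      if_true, mul_add, mul_div_cancel₀ _ hμ]
  constructor
  · rintro ⟨-, hk, -⟩ i hi i' hi'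
    -- Equal dimensions allow the unit vector at `i'` to be lifted to an eigenvector. Its eigenvalue
    -- equation at `i`, multiplied by `μ`, is the `(i, i')` entry of the star set equation.
    have hsurj : Function.Surjective (G.eigenspaceRestrict μ S) :=
      (LinearMap.injective_iff_surjective_of_finrank_eq_finrank (by
        rw [hcard, hk]; rfl)).mp hinj
    obtain ⟨⟨x, hxE⟩, hxS⟩ := hsurj (Pi.single ⟨i', hi'⟩ 1)
    have hxS' (i : V) (hi : i ∈ S) : x i = if i = i' then 1 else 0 := by
      have := congrFun hxS ⟨i, hi⟩
      rw [eigenspaceRestrict_apply] at this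
      simpa [Pi.single_apply] using this
    obtain ⟨h1, h2⟩ := (hx i' hi' x hxS').mp hxE
    rw [← hrow i i' hi' x hxS' h1, h2 i hi, hxS' i hi]
    split_ifs <;> ring
  · intro h
    -- The only possible lift of the unit vector at `i'`; the star set equation makes it an
    -- eigenvector.
    let x (i' : V) : V → ℝ := fun v =>
      if v ∈ S then (if v = i' then 1 else 0) else G.adjMatrix v i' / μ
    have hxS (i' : V) (i : V) (hi : i ∈ S) : x i' i = if i = i' then 1 else 0 := if_pos hi
    have hxT (i' : V) (t : V) (ht : t ∉ S) : x i' t = G.adjMatrix t i' / μ := if_neg ht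
    have hxE (i' : V) (hi' : i' ∈ S) :
        x i' ∈ Module.End.eigenspace G.adjMatrix.mulVecLin μ := by
      rw [hx i' hi' _ (hxS i')]
      refine ⟨hxT i', fun i hi => mul_left_cancel₀ hμ ?_⟩
      rw [hrow i i' hi' _ (hxS i') (hxT i'), ← h i hi i' hi', hxS i' i hi]
      split_ifs <;> ring
    have hsurj : Function.Surjective (G.eigenspaceRestrict μ S) := by
      rw [← LinearMap.range_eq_top, eq_top_iff, ← (Pi.basisFun ℝ S).span_eq, Submodule.span_le]
      rintro _ ⟨⟨i', hi'⟩, rfl⟩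
      refine ⟨⟨x i', hxE i' hi'⟩, ?_⟩
      ext ⟨i, hi⟩
      rw [eigenspaceRestrict_apply]
      simp [hxS i' i hi, Pi.single_apply]
    refine ⟨?_, ?_, ?_⟩
    -- For empty `S` the equation would hold vacuously although `μ` is not an eigenvalue.
    · obtain ⟨i, hi⟩ := hS
      refine Module.End.hasEigenvalue_of_hasEigenvector (x := x i) ⟨hxE i hi, fun h0 => ?_⟩
      have := congrFun h0 i
      simp [hxS i i hi] at this
    · rw [multiplicity, ← hcard]
      exact (LinearEquiv.ofBijective _ ⟨hinj, hsurj⟩).finrank_eq.symm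
    · apply not_isEigenvalue_of_adjMatrix_eq_zero _ hμ
      ext t t'
      rw [adjMatrix_induce]
      exact hT _ t.2 _ t'.2

end StarSet

end SignedGraph

/-! ### Correspondence between bipartite graphs and orthogonal sign rows. -/

namespace SignedGraph

/-- `G` is bipartite between `κ` and `Fin s`, with signs given by the matrix `r`. -/
def HasSigns {V κ : Type*} {s : ℕ} (G : SignedGraph V) (e : V ≃ κ ⊕ Fin s)
    (r : Matrix κ (Fin s) ℤ) : Prop :=
  ∀ u v, G.adjMatrix u v = (Matrix.fromBlocks 0 r r.transpose 0 (e u) (e v) : ℤ)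

section

variable {U : Type*} [Fintype U] {s : ℕ} {μ : ℝ} {H : SignedGraph U}

/-- The bipartite signed graphs that have a totally disconnected star complement are complete
bipartite, with orthogonal rows of signs. -/
theorem HasStarComplement.exists_hasSigns {V : Type*} [Fintype V] {B : SignedGraph V}
    (hs : (s : ℝ) = μ ^ 2) (hs2 : 2 ≤ s) (hH : H.IsTotallyDisconnected)
    (hU : Fintype.card U = s) (hB : B.IsBipartite) (h : B.HasStarComplement H μ) :
    ∃ k : ℕ, 1 ≤ k ∧ Fintype.card V = k + s ∧ ∃ (e : V ≃ Fin k ⊕ Fin s)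
      (r : Matrix (Fin k) (Fin s) ℤ), r.OrthogonalSigns ∧ B.HasSigns e r := by
  classical
  obtain ⟨S, hstar, f, hf⟩ := h
  have hμ : μ ≠ 0 := by
    rintro rfl
    have : s = 0 := by exact_mod_cast (by simpa using hs : (s : ℝ) = 0)
    omega
  have hT : ∀ t ∉ S, ∀ t' ∉ S, B.adjMatrix t t' = 0 := by
    intro t ht t' ht'
    have := congrFun (congrFun hf ⟨t, ht⟩) ⟨t', ht'⟩
    rw [adjMatrix_eq_zero_of_isTotallyDisconnected hH, adjMatrix_induce] at this
    exact this.symm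
  have hS : S.Nonempty := by
    by_contra hS
    rw [Set.not_nonempty_iff_eq_empty] at hS
    refine B.not_isEigenvalue_of_adjMatrix_eq_zero hμ ?_ hstar.1
    ext u v
    exact hT u (by simp [hS]) v (by simp [hS])
  have heq := (B.isStarSet_iff hμ hT hS).mp hstar
  have hcardT : Fintype.card (Sᶜ : Set V) = s := by rw [← hU]; exact Fintype.card_congr f
  have hsumT (g : V → ℝ) : (∑ t, if t ∈ S then 0 else g t) = ∑ t : (Sᶜ : Set V), g t := by
    rw [← Finset.sum_subtype (Finset.univ.filter (· ∉ S)) (by simp) g, Finset.sum_filter]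
    exact Finset.sum_congr rfl fun t _ => by by_cases ht : t ∈ S <;> simp [ht]
  have hsq (i t : V) : B.adjMatrix i t * B.adjMatrix t i ≤ 1 := by
    rw [B.adjMatrix_comm t i]
    rcases B.adjMatrix_entry i t with h | h | h <;> simp [h]
  -- The diagonal equation: `s` terms, each at most 1, add up to `s`, so each equals 1.
  have hST (i : V) (hi : i ∈ S) (t : V) (ht : t ∉ S) :
      B.adjMatrix i t = 1 ∨ B.adjMatrix i t = -1 := by
    have h1 := heq i hi i hi
    rw [if_pos rfl, B.adjMatrix_of_not_adj (SimpleGraph.irrefl _), mul_zero, zero_add, hsumT,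
      ← hs] at h1
    have h2 : ∑ t : (Sᶜ : Set V), (1 - B.adjMatrix i t * B.adjMatrix t i) = 0 := by
      rw [Finset.sum_sub_distrib, ← h1]
      simp [hcardT]
    have h3 := (Finset.sum_eq_zero_iff_of_nonneg fun (t : (Sᶜ : Set V)) _ =>
      sub_nonneg.mpr (hsq i t)).mp h2 ⟨t, ht⟩ (Finset.mem_univ _)
    rcases B.adjMatrix_entry i t with h | h | h
    · simp [h] at h3
    · exact Or.inl h
    · exact Or.inr h
  have hadj (i : V) (hi : i ∈ S) (t : V) (ht : t ∉ S) : B.graph.Adj i t := by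
    rw [← adjMatrix_ne_zero_iff]
    rcases hST i hi t ht with h | h <;> simp [h]
  -- An edge inside `S` would form a triangle with any vertex outside `S`.
  have hSS (i : V) (hi : i ∈ S) (i' : V) (hi' : i' ∈ S) : B.adjMatrix i i' = 0 := by
    apply B.adjMatrix_of_not_adj
    intro hii
    obtain ⟨c⟩ := hB
    have : Nonempty (Sᶜ : Set V) := Fintype.card_pos_iff.mp (by omega)
    obtain ⟨t, ht⟩ := this
    have h1 := c.valid hii
    have h2 := c.valid (hadj i hi t ht)
    have h3 := c.valid (hadj i' hi' t ht)
    omega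
  have hcard : Fintype.card V = Fintype.card S + s := by
    rw [← hcardT, ← Fintype.card_sum]
    exact Fintype.card_congr (Equiv.Set.sumCompl S).symm
  let eS := Fintype.equivFin S
  let eT := Fintype.equivFinOfCardEq hcardT
  let e := (Equiv.Set.sumCompl S).symm.trans (Equiv.sumCongr eS eT)
  let r : Matrix (Fin (Fintype.card S)) (Fin s) ℤ := Matrix.of fun i j =>
    if B.adjMatrix (eS.symm i) (eT.symm j) = 1 then 1 else -1
  have hr (i j) : (r i j : ℝ) = B.adjMatrix (eS.symm i) (eT.symm j) := by
    simp only [r, Matrix.of_apply]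
    rcases hST _ (eS.symm i).2 _ (eT.symm j).2 with h | h <;> rw [h] <;> norm_num
  have heS (v : V) (hv : v ∈ S) : e v = Sum.inl (eS ⟨v, hv⟩) := by
    simp [e, Equiv.Set.sumCompl_symm_apply_of_mem hv]
  have heT (v : V) (hv : v ∉ S) : e v = Sum.inr (eT ⟨v, hv⟩) := by
    simp [e, Equiv.Set.sumCompl_symm_apply_of_notMem hv]
  refine ⟨Fintype.card S, Fintype.card_pos_iff.mpr hS.to_subtype, hcard, e, r, ⟨?_, ?_⟩, ?_⟩
  · intro i j
    simp only [r, Matrix.of_apply]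
    split_ifs <;> simp
  · intro i i' hi
    have h1 := heq _ (eS.symm i).2 _ (eS.symm i').2
    have hne : ((eS.symm i : S) : V) ≠ (eS.symm i' : S) := fun h =>
      hi (eS.symm.injective (Subtype.ext h))
    rw [if_neg hne, hSS _ (eS.symm i).2 _ (eS.symm i').2, mul_zero, zero_add, hsumT] at h1
    have h2 : ((∑ j, r i j * r i' j : ℤ) : ℝ) = 0 := by
      push_cast
      rw [h1]
      refine Fintype.sum_equiv eT.symm _ _ fun j => ?_
      rw [hr, hr, B.adjMatrix_comm (eS.symm i')]
    exact_mod_cast h2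
  · intro u v
    by_cases hu : u ∈ S <;> by_cases hv : v ∈ S
    · simp [heS u hu, heS v hv, hSS u hu v hv]
    · simp [heS u hu, heT v hv, hr]
    · simp [heT u hu, heS v hv, hr, B.adjMatrix_comm u v]
    · simp [heT u hu, heT v hv, hT u hu v hv]

theorem HasSigns.isBipartite {V κ : Type*} {B : SignedGraph V}
    {e : V ≃ κ ⊕ Fin s} {r : Matrix κ (Fin s) ℤ} (h : B.HasSigns e r) : B.IsBipartite := by
  refine ⟨SimpleGraph.Coloring.mk (fun v => if (e v).isLeft then (0 : Fin 2) else 1) ?_⟩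
  intro u v huv
  rw [← adjMatrix_ne_zero_iff, h u v] at huv
  rcases hu : e u with i | i <;> rcases hv : e v with j | j <;> simp [hu, hv] at huv ⊢

/-- The converse direction: with the left part as star set, the star set equation is `r rᵀ = s I`.
-/
theorem HasSigns.hasStarComplement {V κ : Type*} [Fintype V] [Nonempty κ] {B : SignedGraph V}
    {e : V ≃ κ ⊕ Fin s} {r : Matrix κ (Fin s) ℤ} (h : B.HasSigns e r)
    (hr : r.OrthogonalSigns) (hs : (s : ℝ) = μ ^ 2) (hs0 : s ≠ 0)
    (hH : H.IsTotallyDisconnected) (hU : Fintype.card U = s) : B.HasStarComplement H μ := by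
  classical
  have : Fintype κ := Fintype.ofInjective (fun i => e.symm (Sum.inl i))
    (e.symm.injective.comp Sum.inl_injective)
  have hμ : μ ≠ 0 := by
    rintro rfl
    exact hs0 (by exact_mod_cast (by simpa using hs : (s : ℝ) = 0))
  obtain ⟨S, hmem⟩ : ∃ S : Set V, ∀ v, v ∈ S ↔ (e v).isLeft :=
    ⟨{v | (e v).isLeft}, fun _ => Iff.rfl⟩
  have hT : ∀ t ∉ S, ∀ t' ∉ S, B.adjMatrix t t' = 0 := by
    intro t ht t' ht'
    rw [hmem] at ht ht'
    rw [h t t']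
    rcases hu : e t with i | i <;> rcases hv : e t' with j | j <;> simp_all
  have hS : S.Nonempty := ⟨e.symm (Sum.inl (Classical.arbitrary κ)), by simp [hmem]⟩
  refine ⟨S, (B.isStarSet_iff hμ hT hS).mpr ?_, ?_⟩
  · intro v hv v' hv'
    rw [hmem, Sum.isLeft_iff] at hv hv'
    obtain ⟨i, hi⟩ := hv
    obtain ⟨i', hi'⟩ := hv'
    have hsum : (∑ t, if t ∈ S then 0 else B.adjMatrix v t * B.adjMatrix t v') =
        ((∑ j, r i j * r i' j : ℤ) : ℝ) := by
      rw [← Equiv.sum_comp e.symm, Fintype.sum_sum_type]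
      simp [hmem, h v, h _ v', hi, hi']
    have hvv : v = v' ↔ i = i' := by
      rw [← e.apply_eq_iff_eq, hi, hi', Sum.inl.injEq]
    rw [hsum, h v v', hi, hi']
    by_cases hii : i = i'
    · subst hii
      simp [hvv, hr.mul_self, hs]
    · simp [hvv, hii, hr.orthogonal _ _ hii]
  · let f : Fin s → (Sᶜ : Set V) := fun j => ⟨e.symm (Sum.inr j), by simp [hmem]⟩
    have hf : Function.Bijective f := by
      refine ⟨fun j j' hj => ?_, fun ⟨t, ht⟩ => ?_⟩
      · have := congrArg Subtype.val hj
        simpa [f] using this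
      · rw [Set.mem_compl_iff, hmem] at ht
        rcases hu : e t with i | i
        · simp [hu] at ht
        · refine ⟨i, Subtype.ext ?_⟩
          simp [f, ← hu]
    refine ⟨(Equiv.ofBijective f hf).symm.trans (Fintype.equivFinOfCardEq hU).symm, ?_⟩
    ext t t'
    rw [adjMatrix_induce, hT _ t.2 _ t'.2, adjMatrix_eq_zero_of_isTotallyDisconnected hH]
    rfl

theorem exists_hasSigns {V κ : Type*} (e : V ≃ κ ⊕ Fin s) {r : Matrix κ (Fin s) ℤ}
    (hr : r.OrthogonalSigns) : ∃ B : SignedGraph V, B.HasSigns e r := by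
  let M : Matrix V V ℝ := Matrix.of fun u v =>
    ((Matrix.fromBlocks 0 r r.transpose 0 (e u) (e v) : ℤ) : ℝ)
  have hM : M.IsSymm := by
    ext u v
    simp only [M, Matrix.transpose_apply, Matrix.of_apply]
    rcases e u with i | i <;> rcases e v with j | j <;> simp
  have hdiag (v : V) : M v v = 0 := by
    simp only [M, Matrix.of_apply]
    rcases e v with j | j <;> simp
  refine ⟨ofMatrix M hM hdiag, fun u v => ?_⟩
  rw [adjMatrix_ofMatrix M hM hdiag]
  · rfl
  · intro u v
    simp only [M, Matrix.of_apply]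
    rcases e u with i | i <;> rcases e v with j | j
    · simp
    · rcases hr.entry i j with h | h <;> simp [h]
    · rcases hr.entry j i with h | h <;> simp [h]
    · simp

theorem exists_fin_hasStarComplement {k : ℕ} (hk : 1 ≤ k) {r : Matrix (Fin k) (Fin s) ℤ}
    (hr : r.OrthogonalSigns) (hs : (s : ℝ) = μ ^ 2) (hs0 : s ≠ 0)
    (hH : H.IsTotallyDisconnected) (hU : Fintype.card U = s) :
    ∃ B : SignedGraph (Fin (k + s)), B.IsBipartite ∧ B.HasStarComplement H μ := by
  obtain ⟨B, hB⟩ := exists_hasSigns finSumFinEquiv.symm hr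
  have : Nonempty (Fin k) := ⟨⟨0, hk⟩⟩
  exact ⟨B, hB.isBipartite, hB.hasStarComplement hr hs hs0 hH hU⟩

end

/-! ### Standard forms for one, two and `s` rows. -/

section Classification

variable {V : Type*} {s : ℕ} {B : SignedGraph V}

theorem adjMatrix_positiveStar (u v : Fin 1 ⊕ Fin s) :
    (positiveStar s).adjMatrix u v = (Matrix.fromBlocks 0 (Matrix.of fun _ _ => 1)
      (Matrix.of fun _ _ => 1) 0 u v : ℝ) := by
  rcases u with i | i <;> rcases v with j | j <;>
    simp [adjMatrix, PosAdj, NegAdj, positiveStar]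

theorem adjMatrix_halfNegativeK2 (u v : Fin 2 ⊕ Fin s) :
    (halfNegativeK2 s).adjMatrix u v = (Matrix.fromBlocks 0
      (Matrix.of fun (i : Fin 2) (j : Fin s) => if i = 0 ∧ (j : ℕ) < s / 2 then -1 else 1)
      (Matrix.of fun (j : Fin s) (i : Fin 2) => if i = 0 ∧ (j : ℕ) < s / 2 then -1 else 1) 0 u v : ℝ) := by
  rcases u with i | i <;> rcases v with j | j
  · simp [adjMatrix, PosAdj, NegAdj, halfNegativeK2]
  · by_cases hi : i = 0 <;> by_cases hj : (j : ℕ) < s / 2 <;>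
      simp [adjMatrix, PosAdj, NegAdj, halfNegativeK2, hi, hj]
  · by_cases hi : j = 0 <;> by_cases hj : (i : ℕ) < s / 2 <;>
      simp [adjMatrix, PosAdj, NegAdj, halfNegativeK2, hi, hj]
  · simp [adjMatrix, PosAdj, NegAdj, halfNegativeK2]

/-- Switching each leaf by its own sign makes all edges positive. -/
theorem HasSigns.switchingIsomorphic_positiveStar {e : V ≃ Fin 1 ⊕ Fin s}
    {r : Matrix (Fin 1) (Fin s) ℤ} (h : B.HasSigns e r) (hr : r.OrthogonalSigns) :
    B.SwitchingIsomorphic (positiveStar s) := by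
  have hc (j) : (r 0 j : ℝ) = 1 ∨ (r 0 j : ℝ) = -1 := by
    rcases hr.entry 0 j with h | h <;> simp [h]
  refine switchingIsomorphic_of_equiv e
    (fun v => Sum.elim (fun _ => 1) (fun j => (r 0 j : ℝ)) (e v)) ?_ ?_
  · intro v
    rcases e v with i | j
    · simp
    · exact hc j
  · intro u v
    rw [h u v, adjMatrix_positiveStar]
    rcases e u with i | i <;> rcases e v with j | j
    · simp
    · rw [Subsingleton.elim i 0]
      rcases hc j with h | h <;> simp [h]
    · rw [Subsingleton.elim j 0]
      rcases hc i with h | h <;> simp [h]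
    · simp

/-- Switching the columns by row 1 makes that row positive. Orthogonality then leaves exactly `s /
2` negative entries in row 0, which a permutation of the columns moves to the front. -/
theorem HasSigns.switchingIsomorphic_halfNegativeK2 {e : V ≃ Fin 2 ⊕ Fin s}
    {r : Matrix (Fin 2) (Fin s) ℤ} (h : B.HasSigns e r) (hr : r.OrthogonalSigns) :
    B.SwitchingIsomorphic (halfNegativeK2 s) := by
  classical
  have hc (i j) : (r i j : ℝ) = 1 ∨ (r i j : ℝ) = -1 := by
    rcases hr.entry i j with h | h <;> simp [h]
  have h0 := hr.orthogonal 0 1 (by simp)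
  have hcard : Fintype.card {j // r 0 j * r 1 j = -1} =
      Fintype.card {j : Fin s // (j : ℕ) < s / 2} := by
    have h1 (j : Fin s) : r 0 j * r 1 j = 1 - 2 * if r 0 j * r 1 j = -1 then 1 else 0 := by
      rcases hr.entry 0 j with h | h <;> rcases hr.entry 1 j with h' | h' <;> simp [h, h']
    rw [Finset.sum_congr rfl fun j _ => h1 j, Finset.sum_sub_distrib, ← Finset.mul_sum,
      Finset.sum_boole] at h0
    rw [Fintype.card_subtype, Fintype.card_subtype]
    have h2 : (Finset.univ.filter fun j : Fin s => (j : ℕ) < s / 2).card = s / 2 := by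
      rw [Fin.card_filter_val_lt]
      omega
    rw [h2]
    simp at h0
    omega
  let σ : Equiv.Perm (Fin s) := (Fintype.equivOfCardEq hcard).extendSubtype
  have hσ (j : Fin s) : ((σ j : Fin s) : ℕ) < s / 2 ↔ r 0 j * r 1 j = -1 := by
    refine ⟨fun hj => ?_, fun hj => (Fintype.equivOfCardEq hcard).extendSubtype_mem j hj⟩
    by_contra hne
    exact (Fintype.equivOfCardEq hcard).extendSubtype_not_mem j hne hj
  have key (i : Fin 2) (j : Fin s) :
      (if i = 0 ∧ ((σ j : Fin s) : ℕ) < s / 2 then -1 else 1 : ℝ) = r i j * r 1 j := by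
    simp only [hσ]
    rcases hr.entry 0 j with h | h <;> rcases hr.entry 1 j with h' | h' <;> fin_cases i <;>
      simp [h, h']
  refine switchingIsomorphic_of_equiv (e.trans (Equiv.sumCongr (Equiv.refl _) σ))
    (fun v => Sum.elim (fun _ => 1) (fun j => (r 1 j : ℝ)) (e v)) ?_ ?_
  · intro v
    rcases e v with i | j
    · simp
    · exact hc 1 j
  · intro u v
    rw [h u v, adjMatrix_halfNegativeK2]
    simp only [Equiv.trans_apply]
    rcases e u with i | i <;> rcases e v with j | j
    · simp
    · simpa using key i j
    · simpa [mul_comm] using key j i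
    · simp

/-- Both `r rᵀ` and `rᵀ r` equal `s I`, so `A² = s I` and `w₂` vanishes on all distinct pairs. As `s
≥ 2`, some part contains two non-adjacent vertices, so the graph is not complete. -/
theorem HasSigns.isSRG [Fintype V] (hs2 : 2 ≤ s) {e : V ≃ Fin s ⊕ Fin s}
    {r : Matrix (Fin s) (Fin s) ℤ} (h : B.HasSigns e r) (hr : r.OrthogonalSigns) :
    B.IsSRG (2 * s) s 0 0 0 := by
  have hne (i j) : r i j ≠ 0 := by
    rcases hr.entry i j with h | h <;> simp [h]
  have hadj (u v : V) : B.graph.Adj u v ↔ (e u).isLeft ≠ (e v).isLeft := by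
    rw [← adjMatrix_ne_zero_iff, h u v]
    rcases e u with i | i <;> rcases e v with j | j <;> simp [hne]
  have hw (u v : V) (huv : u ≠ v) : B.w₂ u v = 0 := by
    have hsum : (B.w₂ u v : ℝ) = ((∑ x, Matrix.fromBlocks 0 r r.transpose 0 (e u) x *
        Matrix.fromBlocks 0 r r.transpose 0 x (e v) : ℤ) : ℝ) := by
      rw [w₂_eq_sum, ← Equiv.sum_comp e.symm]
      push_cast
      exact Finset.sum_congr rfl fun x _ => by rw [h u, h _ v, e.apply_symm_apply]
    rw [Int.cast_inj] at hsum
    rw [hsum, ← Matrix.mul_apply, Matrix.fromBlocks_multiply]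
    have huv' : e u ≠ e v := fun h' => huv (e.injective h')
    have h1 := hr.mul_transpose
    have h2 := hr.transpose_mul
    simp only [Matrix.zero_mul, Matrix.mul_zero, add_zero, zero_add, h1, h2]
    rcases hu : e u with i | i <;> rcases hv : e v with j | j
    · have hij : i ≠ j := fun h' => huv' (by rw [hu, hv, h'])
      rw [Matrix.fromBlocks_apply₁₁, Matrix.smul_apply, Matrix.one_apply_ne hij, smul_zero]
    · simp
    · simp
    · have hij : i ≠ j := fun h' => huv' (by rw [hu, hv, h'])
      rw [Matrix.fromBlocks_apply₂₂, Matrix.smul_apply, Matrix.one_apply_ne hij, smul_zero]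
  have h0 : 0 < s := by omega
  refine ⟨?_, ?_, ?_, ?_, ?_, ?_, ?_⟩
  · rw [Fintype.card_congr e]; simp; ring
  · intro v
    rcases hv : e v with i | i
    · have : B.graph.neighborSet v = Set.range fun j => e.symm (Sum.inr j) := by
        ext w
        rw [SimpleGraph.mem_neighborSet, hadj, hv]
        simp only [Set.mem_range, Equiv.symm_apply_eq]
        rcases e w with j | j <;> simp
      rw [this, ← Nat.card_coe_set_eq]
      exact (Nat.card_range_of_injective (e.symm.injective.comp Sum.inr_injective)).trans
        (by simp)
    · have : B.graph.neighborSet v = Set.range fun j => e.symm (Sum.inl j) := by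
        ext w
        rw [SimpleGraph.mem_neighborSet, hadj, hv]
        simp only [Set.mem_range, Equiv.symm_apply_eq]
        rcases e w with j | j <;> simp
      rw [this, ← Nat.card_coe_set_eq]
      exact (Nat.card_range_of_injective (e.symm.injective.comp Sum.inl_injective)).trans
        (by simp)
  · rintro ⟨htop, -⟩
    have := hadj (e.symm (Sum.inl ⟨0, h0⟩)) (e.symm (Sum.inl ⟨1, hs2⟩))
    rw [htop] at this
    simp at this
  · intro hbot
    have := hadj (e.symm (Sum.inl ⟨0, h0⟩)) (e.symm (Sum.inr ⟨0, h0⟩))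
    rw [show B.graph = ⊥ from hbot] at this
    simp at this
  · exact fun u v huv => hw u v huv.1.ne
  · exact fun u v huv => hw u v (negAdj_adj huv).ne
  · exact fun u v huv _ => hw u v huv

end Classification

end SignedGraph

/-! ### The main theorem. -/

theorem mainTheorem6 {U : Type*} [Fintype U] (s : ℕ) (μ : ℝ) (hs : (s : ℝ) = μ ^ 2)
    (hs2 : 2 ≤ s) (H : SignedGraph U) (hH : H.IsTotallyDisconnected)
    (hU : Fintype.card U = s) :
    (∃ (n : ℕ) (B : SignedGraph (Fin n)), B.IsMaximalBipartite H μ) ∧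
    ∀ (V : Type*) [Fintype V] (B : SignedGraph V), B.IsMaximalBipartite H μ →
      (Odd s → B.SwitchingIsomorphic (SignedGraph.positiveStar s)) ∧
      (s % 4 = 2 → B.SwitchingIsomorphic (SignedGraph.halfNegativeK2 s)) ∧
      (s ∈ hadamardOrders → B.IsSRG (2 * s) s 0 0 0 ∧
        ∃ K : SignedGraph V, K.IsSRG (2 * s) s 0 0 0 ∧ B.SwitchingIsomorphic K) := by
  classical
  have hs0 : s ≠ 0 := by omega
  constructor
  -- One row always exists and there are never more than `s`, so a largest number of rows exists.
  · let P : ℕ → Prop := fun k => 1 ≤ k ∧ ∃ r : Matrix (Fin k) (Fin s) ℤ, r.OrthogonalSigns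
    have hP : P (Nat.findGreatest P s) :=
      Nat.findGreatest_spec (m := 1) (by omega) ⟨le_rfl, _, Matrix.orthogonalSigns_one s⟩
    obtain ⟨hk, r, hr⟩ := hP
    obtain ⟨B, hB, hBH⟩ := SignedGraph.exists_fin_hasStarComplement hk hr hs hs0 hH hU
    refine ⟨_, B, hB, hBH, fun n B' hB' hB'H => ?_⟩
    obtain ⟨k', hk', hn, -, r', hr', -⟩ := hB'H.exists_hasSigns hs hs2 hH hU hB'
    have hle : k' ≤ Nat.findGreatest P s :=
      Nat.le_findGreatest (by simpa using hr'.card_le hs0) ⟨hk', r', hr'⟩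
    rw [Fintype.card_fin] at hn ⊢
    omega
  · rintro V _ B ⟨hB, hBH, hmax⟩
    obtain ⟨k, hk, hn, e, r, hr, hBr⟩ := hBH.exists_hasSigns hs hs2 hH hU hB
    have hbound (k' : ℕ) (hk' : 1 ≤ k') (r' : Matrix (Fin k') (Fin s) ℤ)
        (hr' : r'.OrthogonalSigns) : k' ≤ k := by
      obtain ⟨B', hB', hB'H⟩ := SignedGraph.exists_fin_hasStarComplement hk' hr' hs hs0 hH hU
      have := hmax _ B' hB' hB'H
      omega
    refine ⟨fun hodd => ?_, fun h2 => ?_, fun hmem => ?_⟩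
    -- Parity alone excludes a second row.
    · have hk1 : k = 1 := by
        by_contra hk1
        have hne : (⟨0, hk⟩ : Fin k) ≠ ⟨1, by omega⟩ := by simp
        exact (Nat.not_even_iff_odd.mpr hodd) (hr.even hne)
      subst hk1
      exact hBr.switchingIsomorphic_positiveStar hr
    -- Two rows exist since `s` is even, so maximality gives `k ≥ 2`; a third would force `4 ∣ s`.
    · have hk2 : k = 2 := by
        obtain ⟨r', hr'⟩ := Matrix.exists_orthogonalSigns_two
          (Nat.even_iff.mpr (by omega : s % 2 = 0))
        have := hbound 2 (by omega) r' hr'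
        by_contra hk2
        have := hr.four_dvd (i := ⟨0, hk⟩) (j := ⟨1, by omega⟩) (k := ⟨2, by omega⟩)
          (by simp) (by simp) (by simp)
        omega
      subst hk2
      exact hBr.switchingIsomorphic_halfNegativeK2 hr
    · have hks : k = s := by
        obtain ⟨r', hr'⟩ := (Matrix.hadamardExists_of_mem_hadamardOrders hmem).orthogonalSigns
        refine le_antisymm (by simpa using hr.card_le hs0) (hbound s (by omega) r' hr')
      subst hks
      have hsrg := hBr.isSRG hs2 hr
      exact ⟨hsrg, B, hsrg, B.switchingIsomorphic_refl⟩
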